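/- Let $\mathscr C$ be a full commutative C*-category. Here a C*-category is a category whose morphism spaces $\mathscr C_{AB}:=\mathrm{Hom}(B,A)$ are complex Banach spaces, whose composition is bilinear with $\|xy\|\le\|x\|\,\|y\|$, and which carries an involutive antilinear contravariant functor $x\mapsto x^*$, the identity on objects, such that $\|x^*x\|=\|x\|^2$ and, for every $x\in\mathscr C_{BA}$, $x^*x=y^*y$ for some $y\in\mathscr C_{AA}$. So the $\mathscr C_{AA}$ are unital C*-algebras, and $\mathscr C_{AB}$ is a $\mathscr C_{AA}$-$\mathscr C_{BB}$-bimodule under composition, with inner products ${}_{A}\langle x,y\rangle=xy^*\in\mathscr C_{AA}$ and $\langle x,y\rangle_{B}=x^*y\in\mathscr C_{BB}$. The category is full if for all objects $A,B$ the linear spans of $\{xy^*: x,y\in\mathscr C_{AB}\}$ and $\{x^*y: x,y\in\mathscr C_{AB}\}$ are dense in $\mathscr C_{AA}$ and $\mathscr C_{BB}$ respectively; it is commutative if every $\mathscr C_{AA}$ is commutative. Then, for every pair of objects $A,B$: 1. $\mathscr C_{AB}$, with these inner products, is a $\mathscr C_{AA}$-$\mathscr C_{BB}$ imprimitivity bimodule,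 i.e. a Hilbert C*-bimodule (complete for both norms) that is full on both sides and satisfies ${}_A\langle x,y\rangle z=x\langle y,z\rangle_B$ for all $x,y,z\in\mathscr C_{AB}$. In particular $\mathscr C_{AA}$ and $\mathscr C_{BB}$ are Morita equivalent. 2. There is a unique $*$-isomorphism $\varphi:\mathscr C_{BB}\to\mathscr C_{AA}$ with $\varphi(x^*y)=yx^*$ for all $x,y\in\mathscr C_{AB}$. 3. Let $X_A,X_B$ be the Gel'fand spectra of $\mathscr C_{AA},\mathscr C_{BB}$, let $R:X_A\to X_B$, $\chi\mapsto\chi\circ\varphi$, be the induced homeomorphism, and identify $R$ with its graph $\{(p,q)\in X_A\times X_B: q=R(p)\}$. There are a Hermitian line bundle $E$ over this graph and an additive bijection $\Phi$ from $\mathscr C_{AB}$ onto the space $\Gamma(R;E)$ of continuous sections of $E$ such that, for all $x,y\in\mathscr C_{AB}$, $a\in\mathscr C_{AA}$, $b\in\mathscr C_{BB}$ and $(p,q)\in R$, $$\Phi(axb)(p,q)=p(a)\,\Phi(x)(p,q)\,q(b),\qquad \langle\Phi(x)(p,q),\Phi(y)(p,q)\rangle=q(x^*y)=p(yx^*),$$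 the fibre inner product being linear in the second variable. That is, $\mathscr C_{AB}$ is isomorphic, as a Hilbert C*-bimodule, to the (in general non-symmetric) bimodule of continuous sections of $E$. -/

import Mathlib

open CategoryTheory MulOpposite Topology Bundle

universe u v w

noncomputable section

/-! ### C*-categories -/

/-- A C*-category: the hom-sets are complex Banach spaces, composition is bilinear and
submultiplicative, and there is an involutive antilinear contravariant functor `adj`, the identity
on objects, satisfying the C*-identity and such that `x* x` is a positive element of the
endomorphism algebra of the source of `x`. -/
class CStarCategory (C : Type u) [Category.{v} C] where
  [normedAddCommGroup : ∀ X Y : C, NormedAddCommGroup (X ⟶ Y)]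
  [normedSpace : ∀ X Y : C, NormedSpace ℂ (X ⟶ Y)]
  [completeSpace : ∀ X Y : C, CompleteSpace (X ⟶ Y)]
  add_comp : ∀ {X Y Z : C} (x x' : X ⟶ Y) (y : Y ⟶ Z), (x + x') ≫ y = x ≫ y + x' ≫ y
  comp_add : ∀ {X Y Z : C} (x : X ⟶ Y) (y y' : Y ⟶ Z), x ≫ (y + y') = x ≫ y + x ≫ y'
  smul_comp : ∀ {X Y Z : C} (c : ℂ) (x : X ⟶ Y) (y : Y ⟶ Z), (c • x) ≫ y = c • (x ≫ y)
  comp_smul : ∀ {X Y Z : C} (c : ℂ) (x : X ⟶ Y) (y : Y ⟶ Z), x ≫ (c • y) = c • (x ≫ y)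
  norm_comp_le : ∀ {X Y Z : C} (x : X ⟶ Y) (y : Y ⟶ Z), ‖x ≫ y‖ ≤ ‖x‖ * ‖y‖
  /-- The involution `x ↦ x*`. -/
  adj : ∀ {X Y : C}, (X ⟶ Y) → (Y ⟶ X)
  adj_id : ∀ X : C, adj (𝟙 X) = 𝟙 X
  adj_comp : ∀ {X Y Z : C} (x : X ⟶ Y) (y : Y ⟶ Z), adj (x ≫ y) = adj y ≫ adj x
  adj_adj : ∀ {X Y : C} (x : X ⟶ Y), adj (adj x) = x
  adj_add : ∀ {X Y : C} (x y : X ⟶ Y), adj (x + y) = adj x + adj y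
  adj_smul : ∀ {X Y : C} (c : ℂ) (x : X ⟶ Y), adj (c • x) = (starRingEnd ℂ c) • adj x
  norm_comp_adj : ∀ {X Y : C} (x : X ⟶ Y), ‖x ≫ adj x‖ = ‖x‖ ^ 2
  exists_comp_adj_eq : ∀ {X Y : C} (x : X ⟶ Y), ∃ y : X ⟶ X, x ≫ adj x = y ≫ adj y

namespace CStarCategory

attribute [reducible, instance] normedAddCommGroup normedSpace
attribute [instance] completeSpace

variable {C : Type u} [Category.{v} C] [CStarCategory C]

theorem zero_comp' {X Y Z : C} (y : Y ⟶ Z) : (0 : X ⟶ Y) ≫ y = 0 := by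
  have h := smul_comp (0 : ℂ) (0 : X ⟶ Y) y
  simpa using h

theorem comp_zero' {X Y Z : C} (x : X ⟶ Y) : x ≫ (0 : Y ⟶ Z) = 0 := by
  have h := comp_smul (0 : ℂ) x (0 : Y ⟶ Z)
  simpa using h

/-- The diagonal block `End A` is a normed ring; its product is composition, `a * b = a ∘ b`. -/
instance instNormedRingEnd (A : C) : NormedRing (End A) :=
  { normedAddCommGroup A A, (inferInstance : Monoid (End A)) with
    left_distrib := fun a b c => add_comp (X := A) (Y := A) (Z := A) b c a
    right_distrib := fun a b c => comp_add (X := A) (Y := A) (Z := A) c a b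
    zero_mul := fun a => comp_zero' (X := A) (Y := A) (Z := A) a
    mul_zero := fun a => zero_comp' (X := A) (Y := A) (Z := A) a
    norm_mul_le := fun a b =>
      (norm_comp_le (X := A) (Y := A) (Z := A) b a).trans_eq (mul_comm _ _) }

instance instNormedAlgebraEnd (A : C) : NormedAlgebra ℂ (End A) where
  smul := (normedSpace A A).smul
  algebraMap :=
    { toFun := fun c => (c • 𝟙 A : A ⟶ A)
      map_one' := one_smul ℂ (𝟙 A)
      map_mul' := fun c d => by
        change ((c * d) • 𝟙 A : A ⟶ A) = (d • 𝟙 A) ≫ (c • 𝟙 A)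
        rw [smul_comp, comp_smul, Category.comp_id, smul_smul, mul_comm]
      map_zero' := zero_smul ℂ (𝟙 A)
      map_add' := fun c d => add_smul c d (𝟙 A) }
  commutes' c a := by
    change (show A ⟶ A from a) ≫ (c • 𝟙 A) = (c • 𝟙 A) ≫ (show A ⟶ A from a)
    rw [smul_comp, comp_smul, Category.comp_id, Category.id_comp]
  smul_def' c a := by
    change c • (show A ⟶ A from a) = (show A ⟶ A from a) ≫ (c • 𝟙 A)
    rw [comp_smul, Category.comp_id]
  norm_smul_le c a := (normedSpace A A).norm_smul_le c a

/-- The diagonal block `End A` is a unital C*-algebra. -/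
instance instCStarAlgebraEnd (A : C) : CStarAlgebra (End A) :=
  { instNormedRingEnd A, instNormedAlgebraEnd A with
    star := fun a => adj (X := A) (Y := A) a
    star_involutive := fun a => adj_adj (X := A) (Y := A) a
    star_mul := fun a b => adj_comp (X := A) (Y := A) (Z := A) b a
    star_add := fun a b => adj_add (X := A) (Y := A) a b
    norm_mul_self_le := fun a =>
      ((norm_comp_adj (X := A) (Y := A) a).trans (pow_two _)).ge
    complete := (completeSpace A A).complete
    star_smul := fun c a => adj_smul (X := A) (Y := A) c a }

/-- `Hom(B, A)` is a left module over `End A` by composition: `a • x = a ∘ x`. -/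
instance instModuleEnd (A B : C) : Module (End A) (B ⟶ A) :=
  { End.mulActionRight with
    smul_zero := fun a => zero_comp' (X := B) (Y := A) (Z := A) a
    smul_add := fun a x y => add_comp (Z := A) x y a
    add_smul := fun a b x => comp_add (Y := A) (Z := A) x a b
    zero_smul := fun x => comp_zero' (Y := A) (Z := A) x }

/-- `Hom(B, A)` is a right module over `End B` by composition: `op b • x = x ∘ b`. -/
instance instModuleEndOp (A B : C) : Module (End B)ᵐᵒᵖ (B ⟶ A) :=
  { End.mulActionLeft with
    smul_zero := fun b => comp_zero' (X := B) (Y := B) (Z := A) b.unop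
    smul_add := fun b x y => comp_add (X := B) (Y := B) (Z := A) b.unop x y
    add_smul := fun b c x => add_comp (X := B) (Y := B) (Z := A) b.unop c.unop x
    zero_smul := fun x => zero_comp' (X := B) (Y := B) (Z := A) x }

/-- The `End A`-valued inner product `x ∘ y*` on `Hom(B, A)`, linear in the first variable. -/
def leftInner {A B : C} (x y : B ⟶ A) : End A := End.of (adj y ≫ x)

/-- The `End B`-valued inner product `x* ∘ y` on `Hom(B, A)`, linear in the second variable. -/
def rightInner {A B : C} (x y : B ⟶ A) : End B := End.of (y ≫ adj x)

end CStarCategory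

/-! ### Hilbert C*-bimodules -/

/-- Completeness of an additive group with respect to the metric `‖x - y‖` of a norm
`nrm`: every Cauchy sequence converges. -/
def CompleteForNorm {M : Type*} [AddCommGroup M] (nrm : M → ℝ) : Prop :=
  ∀ s : ℕ → M, (∀ ε > 0, ∃ N, ∀ m ≥ N, ∀ n ≥ N, nrm (s m - s n) < ε) →
    ∃ x, Filter.Tendsto (fun n => nrm (s n - x)) Filter.atTop (𝓝 0)

section Bimodule

variable {A B M : Type*} [CStarAlgebra A] [CStarAlgebra B] [AddCommGroup M] [Module A M]
  [Module Bᵐᵒᵖ M]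

/-- `M` is a Hilbert C*-bimodule over the unital C*-algebras `A` (acting on the left) and `B`
(acting on the right), with `A`-valued inner product `l` and `B`-valued inner product `r`. -/
structure IsHilbertBimodule (l : M → M → A) (r : M → M → B) : Prop where
  smul_comm : ∀ (a : A) (b : B) (x : M), op b • a • x = a • op b • x
  complex_smul : ∀ (c : ℂ) (x : M), algebraMap ℂ A c • x = op (algebraMap ℂ B c) • x
  left_add : ∀ x y z, l (x + y) z = l x z + l y z
  left_smul : ∀ (a : A) (x y : M), l (a • x) y = a * l x y
  left_star : ∀ x y, l y x = star (l x y)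
  left_nonneg : ∀ x, ∃ a : A, l x x = star a * a
  left_definite : ∀ x, l x x = 0 → x = 0
  right_add : ∀ x y z, r z (x + y) = r z x + r z y
  right_smul : ∀ (b : B) (x y : M), r x (op b • y) = r x y * b
  right_star : ∀ x y, r y x = star (r x y)
  right_nonneg : ∀ x, ∃ b : B, r x x = star b * b
  right_definite : ∀ x, r x x = 0 → x = 0
  right_left_smul : ∀ (a : A) (x y : M), r x (a • y) = r (star a • x) y
  left_right_smul : ∀ (b : B) (x y : M), l (op b • x) y = l x (op (star b) • y)
  left_complete : CompleteForNorm fun x => √‖l x x‖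
  right_complete : CompleteForNorm fun x => √‖r x x‖

/-- A form with values in a C*-algebra is full if its values span a dense subspace. -/
def IsFullForm (l : M → M → A) : Prop :=
  closure (Submodule.span ℂ (Set.range fun p : M × M => l p.1 p.2) : Set A) = Set.univ

/-- `M` is an `A`-`B` imprimitivity bimodule: a Hilbert C*-bimodule, full on both sides, with
`⟨x, y⟩_left • z = x • ⟨y, z⟩_right`. -/
structure IsImprimitivityBimodule (l : M → M → A) (r : M → M → B) : Prop
    extends IsHilbertBimodule l r where
  left_full : IsFullForm l
  right_full : IsFullForm r
  imprimitivity : ∀ x y z : M, l x y • z = op (r y z) • x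

end Bimodule

namespace CStarCategory

variable (C : Type u) [Category.{v} C] [CStarCategory C]

/-- A C*-category is full if every bimodule `Hom(B, A)` is full on both sides. -/
def IsFull : Prop :=
  ∀ A B : C, IsFullForm (leftInner (A := A) (B := B)) ∧ IsFullForm (rightInner (A := A) (B := B))

/-- A C*-category is commutative if all its diagonal blocks are commutative algebras. -/
def IsCommutative : Prop :=
  ∀ (A : C) (a b : End A), a * b = b * a

end CStarCategory

/-! ### Gel'fand spectra -/

section Spectrum

open WeakDual

variable {A B : Type*} [CStarAlgebra A] [CStarAlgebra B]

/-- The homeomorphism `χ ↦ χ ∘ φ` of Gel'fand spectra induced by a *-isomorphism `φ : B → A`. -/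
def spectrumHomeo (φ : B ≃⋆ₐ[ℂ] A) : characterSpace ℂ A ≃ₜ characterSpace ℂ B where
  toFun := CharacterSpace.compContinuousMap (φ : B →⋆ₐ[ℂ] A)
  invFun := CharacterSpace.compContinuousMap (φ.symm : A →⋆ₐ[ℂ] B)
  left_inv := fun χ => CharacterSpace.ext fun a => congrArg χ (φ.apply_symm_apply a)
  right_inv := fun χ => CharacterSpace.ext fun b => congrArg χ (φ.symm_apply_apply b)
  continuous_toFun := ContinuousMap.continuous _
  continuous_invFun := ContinuousMap.continuous _

theorem spectrumHomeo_apply (φ : B ≃⋆ₐ[ℂ] A) (χ : characterSpace ℂ A) (b : B) :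
    spectrumHomeo φ χ b = χ (φ b) := rfl

end Spectrum

section Graph

variable {X Y : Type*} [TopologicalSpace X] [TopologicalSpace Y]

/-- The graph of a homeomorphism, as a subspace of the product. -/
abbrev HomeoGraph (R : X ≃ₜ Y) : Type _ := {p : X × Y // R p.1 = p.2}

/-- The projection of the graph to the source. -/
def graphFst (R : X ≃ₜ Y) : C(HomeoGraph R, X) :=
  ⟨fun p => p.1.1, continuous_fst.comp continuous_subtype_val⟩

/-- The projection of the graph to the target. -/
def graphSnd (R : X ≃ₜ Y) : C(HomeoGraph R, Y) :=
  ⟨fun p => p.1.2, continuous_snd.comp continuous_subtype_val⟩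

end Graph

/-! ### Hermitian line bundles and their continuous sections -/

/-- A Hermitian line bundle over `X`: a locally trivial complex vector bundle with model fibre `ℂ`,
with a Hermitian inner product on each fibre (inducing the topology of the fibre) which is a
continuous function on the fibre product of the bundle with itself. -/
structure HermitianLineBundle (X : Type u) [TopologicalSpace X] where
  Fiber : X → Type w
  [normedAddCommGroup : ∀ x, NormedAddCommGroup (Fiber x)]
  [innerProductSpace : ∀ x, InnerProductSpace ℂ (Fiber x)]
  [topologicalSpace : TopologicalSpace (TotalSpace ℂ Fiber)]
  [fiberBundle : FiberBundle ℂ Fiber]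
  [vectorBundle : VectorBundle ℂ ℂ Fiber]
  continuous_inner :
    Continuous fun p : TotalSpace (ℂ × ℂ) (Fiber ×ᵇ Fiber) => inner ℂ p.2.1 p.2.2

namespace HermitianLineBundle

attribute [instance] normedAddCommGroup innerProductSpace topologicalSpace fiberBundle vectorBundle

variable {X : Type u} [TopologicalSpace X] (L : HermitianLineBundle.{u, w} X)

theorem continuous_section_add {s t : ∀ x, L.Fiber x}
    (hs : Continuous fun x => TotalSpace.mk' ℂ x (s x))
    (ht : Continuous fun x => TotalSpace.mk' ℂ x (t x)) :
    Continuous fun x => TotalSpace.mk' ℂ x (s x + t x) := by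
  rw [continuous_iff_continuousAt] at hs ht ⊢
  intro x₀
  have hs' := (FiberBundle.continuousAt_totalSpace ℂ _).1 (hs x₀)
  have ht' := (FiberBundle.continuousAt_totalSpace ℂ _).1 (ht x₀)
  refine (FiberBundle.continuousAt_totalSpace ℂ _).2 ⟨continuousAt_id, ?_⟩
  refine (hs'.2.add ht'.2).congr ?_
  filter_upwards [(trivializationAt ℂ L.Fiber x₀).open_baseSet.mem_nhds
    (FiberBundle.mem_baseSet_trivializationAt' x₀)] with x hx
  exact (((trivializationAt ℂ L.Fiber x₀).linear ℂ hx).1 (s x) (t x)).symm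

theorem continuous_section_smul {f : X → ℂ} (hf : Continuous f) {s : ∀ x, L.Fiber x}
    (hs : Continuous fun x => TotalSpace.mk' ℂ x (s x)) :
    Continuous fun x => TotalSpace.mk' ℂ x (f x • s x) := by
  rw [continuous_iff_continuousAt] at hs ⊢
  intro x₀
  have hs' := (FiberBundle.continuousAt_totalSpace ℂ _).1 (hs x₀)
  refine (FiberBundle.continuousAt_totalSpace ℂ _).2 ⟨continuousAt_id, ?_⟩
  refine (hf.continuousAt.smul hs'.2).congr ?_
  filter_upwards [(trivializationAt ℂ L.Fiber x₀).open_baseSet.mem_nhds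
    (FiberBundle.mem_baseSet_trivializationAt' x₀)] with x hx
  exact (((trivializationAt ℂ L.Fiber x₀).linear ℂ hx).2 (f x) (s x)).symm

/-- The group of continuous sections of a Hermitian line bundle. -/
def sections : AddSubgroup (∀ x, L.Fiber x) where
  carrier := {s | Continuous fun x => TotalSpace.mk' ℂ x (s x)}
  add_mem' := fun hs ht => L.continuous_section_add hs ht
  zero_mem' := Bundle.Trivialization.continuous_zeroSection ℂ
  neg_mem' := fun {s} hs => by
    have h := L.continuous_section_smul (f := fun _ => (-1 : ℂ)) continuous_const hs
    simpa using h

/-- Continuous sections form a module over the continuous functions on the base. -/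
instance : Module C(X, ℂ) L.sections where
  smul f s := ⟨fun x => f x • s.1 x, L.continuous_section_smul f.continuous s.2⟩
  one_smul s := Subtype.ext <| funext fun x => one_smul ℂ (s.1 x)
  mul_smul f g s := Subtype.ext <| funext fun x => mul_smul (f x) (g x) (s.1 x)
  smul_zero f := Subtype.ext <| funext fun x => smul_zero (f x)
  smul_add f s t := Subtype.ext <| funext fun x => smul_add (f x) (s.1 x) (t.1 x)
  add_smul f g s := Subtype.ext <| funext fun x => add_smul (f x) (g x) (s.1 x)
  zero_smul s := Subtype.ext <| funext fun x => zero_smul ℂ (s.1 x)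

theorem smul_apply (f : C(X, ℂ)) (s : L.sections) (x : X) : (f • s).1 x = f x • s.1 x := rfl

/-- The `C(X, ℂ)`-valued inner product of continuous sections, linear in the second variable. -/
def sectionInner (s t : L.sections) : C(X, ℂ) where
  toFun x := inner ℂ (s.1 x) (t.1 x)
  continuous_toFun := by
    have h : Continuous fun x =>
        (⟨x, (s.1 x, t.1 x)⟩ : TotalSpace (ℂ × ℂ) (L.Fiber ×ᵇ L.Fiber)) :=
      (FiberBundle.Prod.isInducing_diag ℂ L.Fiber ℂ L.Fiber).continuous_iff.2
        (s.2.prodMk t.2)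
    exact L.continuous_inner.comp h

end HermitianLineBundle

/-- An isomorphism of Hilbert C*-bimodules from the `A`-`B` bimodule `M`, with inner products `l`
and `r`, to the bimodule of continuous sections of a Hermitian line bundle `L` over the graph of a
homeomorphism `R` of the Gel'fand spectra. There `a` in `A` acts on the left as multiplication by
its Gel'fand transform pulled back to the graph, `b` in `B` acts on the right likewise, and the two
inner products correspond to the pointwise one. -/
structure SectionIso {A B : Type*} {M : Type*} [CStarAlgebra A] [CStarAlgebra B]
    [AddCommGroup M] [Module A M] [Module Bᵐᵒᵖ M] (l : M → M → A) (r : M → M → B)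
    (R : WeakDual.characterSpace ℂ A ≃ₜ WeakDual.characterSpace ℂ B)
    (L : HermitianLineBundle.{_, w} (HomeoGraph R)) where
  toAddEquiv : M ≃+ L.sections
  map_smul : ∀ (a : A) (x : M), toAddEquiv (a • x) =
    (WeakDual.gelfandTransform ℂ A a).comp (graphFst R) • toAddEquiv x
  map_op_smul : ∀ (b : B) (x : M), toAddEquiv (op b • x) =
    (WeakDual.gelfandTransform ℂ B b).comp (graphSnd R) • toAddEquiv x
  map_left : ∀ x y : M, (WeakDual.gelfandTransform ℂ A (l x y)).comp (graphFst R) =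
    L.sectionInner (toAddEquiv y) (toAddEquiv x)
  map_right : ∀ x y : M, (WeakDual.gelfandTransform ℂ B (r x y)).comp (graphSnd R) =
    L.sectionInner (toAddEquiv x) (toAddEquiv y)

end

noncomputable section

/-! ### Commutative C*-algebras and dense forms -/

/-! In the notation of composition of operators (so that `x ≫ adj x` is x*x), each character χ of
`End A` gives the semi-inner product ⟨x, y⟩ = χ(yx*) on `B ⟶ A`; the quotient by its null vectors is
the fibre at χ. Commutativity of `End B` lets e*e and x*x change places in e(x*x)(e*e)(x*x)e*, and χ
turns this into |⟨e, x⟩|⁴ = ⟨e, e⟩⟨x, x⟩|⟨e, x⟩|². Hence no two nonzero vectors of a fibre are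
orthogonal, and the fibre has dimension at most one (`charFiber_inner_smul`). By Gel'fand duality
this lifts to zy*x = xy*z in the category (`comp_adj_comp_swap`).

Fullness gives finite sums, not only limits: a dense left ideal of a unital Banach algebra contains
a unit. From 1 = ∑ uᵢ*zᵢ in `End B` one sets φ(b) = ∑ zᵢbuᵢ*; commutativity of `End A` gives φ(x*y)
= yx*, and the swap identity makes φ multiplicative.

From 1 = ∑ yᵢxᵢ* in `End A` it follows that no fibre vanishes, so the classes [x] trivialize a line
bundle locally through v ↦ ⟨[x], v⟩. For a continuous section τ, Gel'fand duality supplies aᵢ with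
transform ⟨[xᵢ], τ⟩, and ∑ aᵢyᵢ represents τ: in dimension one ⟨[xᵢ], τ⟩[yᵢ] = ⟨[xᵢ], [yᵢ]⟩τ, and
these sum to τ (`exists_toCharFiber_eq`). -/

theorem gelfandTransform_bijective_of_commute {A : Type*} [i : CStarAlgebra A]
    (h : ∀ a b : A, a * b = b * a) :
    Function.Bijective (WeakDual.gelfandTransform ℂ A) := by
  let _ : CommCStarAlgebra A := { i with mul_comm := h }
  exact gelfandTransform_bijective A

theorem eq_of_forall_character_eq {A : Type*} [CStarAlgebra A] (h : ∀ a b : A, a * b = b * a)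
    {a b : A} (hab : ∀ χ : WeakDual.characterSpace ℂ A, χ a = χ b) : a = b :=
  (gelfandTransform_bijective_of_commute h).1 (ContinuousMap.ext hab)

/-- A dense subspace of a unital Banach algebra which is a left ideal is everything. -/
theorem Submodule.eq_top_of_closure_eq_univ {A : Type*} [NormedRing A] [NormedAlgebra ℂ A]
    [CompleteSpace A] (S : Submodule ℂ A) (hS : closure (S : Set A) = Set.univ)
    (hmul : ∀ a, ∀ b ∈ S, a * b ∈ S) : S = ⊤ := by
  have hd : Dense (S : Set A) := fun x => by rw [hS]; trivial
  -- The units form a nonempty open set, so the dense subspace contains a unit c; then a = (a c⁻¹) c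
  -- lies in it.
  obtain ⟨b, hb, hbS⟩ := hd.inter_open_nonempty {a : A | IsUnit a} Units.isOpen ⟨1, isUnit_one⟩
  obtain ⟨c, rfl⟩ := hb
  refine (Submodule.eq_top_iff').2 fun a => ?_
  have := hmul (a * ((c⁻¹ : Aˣ) : A)) _ hbS
  simpa [mul_assoc] using this

/-! ### Inner product spaces of dimension at most one -/

section RankOne

variable {E : Type*} [NormedAddCommGroup E] [InnerProductSpace ℂ E]

/-- An inner product space in which `⟪b, b⟫ ⟪x, x⟫ = |⟪b, x⟫|²` whenever `⟪b, x⟫ ≠ 0` has dimension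
at most one. -/
theorem inner_smul_eq_inner_smul_of_sq
    (h : ∀ e x : E, (inner ℂ x e * inner ℂ e x) ^ 2 =
      inner ℂ e e * inner ℂ x x * (inner ℂ x e * inner ℂ e x))
    (a b c : E) : inner ℂ a b • c = inner ℂ a c • b := by
  have key : ∀ e x : E, e ≠ 0 → inner ℂ e x = 0 → x = 0 := by
    intro e x he hx
    -- For orthogonal e and x the hypothesis is vacuous; at e and x + e it reads ⟨e, e⟩³⟨x, x⟩ = 0.
    have hx' : inner ℂ x e = 0 := inner_eq_zero_symm.1 hx
    have h1 := h e (x + e)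
    have he' : inner ℂ e e ≠ 0 := inner_self_ne_zero.2 he
    simp only [inner_add_left, inner_add_right, hx, hx', zero_add, add_zero] at h1
    have h2 : inner ℂ e e ^ 3 * inner ℂ x x = 0 := by linear_combination -h1
    exact inner_self_eq_zero.1 ((mul_eq_zero.1 h2).resolve_left (pow_ne_zero _ he'))
  rcases eq_or_ne b 0 with rfl | hb
  · simp
  have hb' : inner ℂ b b ≠ 0 := inner_self_ne_zero.2 hb
  -- The component of c orthogonal to b vanishes, so c is a multiple of b.
  have h1 := key b (c - (inner ℂ b c / inner ℂ b b) • b) hb (by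
    rw [inner_sub_right, inner_smul_right, div_mul_cancel₀ _ hb', sub_self])
  rw [sub_eq_zero] at h1
  rw [h1, inner_smul_right, smul_smul, mul_comm]

end RankOne

namespace CStarCategory

variable {C : Type u} [Category.{v} C] [CStarCategory C]

/-! ### The involution and the inner products -/

/-- From ‖x‖² = ‖x*x‖ ≤ ‖x‖‖x*‖, applied to x and to x*. -/
theorem norm_adj {X Y : C} (x : X ⟶ Y) : ‖adj x‖ = ‖x‖ := by
  have key : ∀ {X Y : C} (x : X ⟶ Y), ‖x‖ ≤ ‖adj x‖ := by
    intro X Y x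
    have h := norm_comp_le x (adj x)
    rw [norm_comp_adj, pow_two] at h
    rcases (norm_nonneg x).eq_or_lt with h0 | h0
    · rw [← h0]; exact norm_nonneg _
    · exact le_of_mul_le_mul_left h h0
  exact le_antisymm (by simpa only [adj_adj] using key (adj x)) (key x)

theorem comp_adj_eq_zero {X Y : C} {x : X ⟶ Y} (h : x ≫ adj x = 0) : x = 0 := by
  have h1 := norm_comp_adj x
  rw [h, norm_zero] at h1
  exact norm_eq_zero.1 (pow_eq_zero_iff two_ne_zero |>.1 h1.symm)

theorem norm_rightInner_self {A B : C} (x : B ⟶ A) : ‖rightInner x x‖ = ‖x‖ ^ 2 :=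
  norm_comp_adj x

theorem norm_leftInner_self {A B : C} (x : B ⟶ A) : ‖leftInner x x‖ = ‖x‖ ^ 2 := by
  have h := norm_comp_adj (adj x)
  rw [adj_adj, norm_adj] at h
  exact h

theorem comp_sub' {X Y Z : C} (x : X ⟶ Y) (y y' : Y ⟶ Z) :
    x ≫ (y - y') = x ≫ y - x ≫ y' := by
  rw [eq_sub_iff_add_eq, ← comp_add, sub_add_cancel]

theorem completeForNorm_of_eq {A B : C} {nrm : (B ⟶ A) → ℝ} (h : ∀ x, nrm x = ‖x‖) :
    CompleteForNorm nrm := by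
  obtain rfl : nrm = norm := funext h
  intro s hs
  have hc : CauchySeq s := Metric.cauchySeq_iff.2 fun ε hε => by
    simpa only [dist_eq_norm] using hs ε hε
  obtain ⟨x, hx⟩ := cauchySeq_tendsto_of_complete hc
  exact ⟨x, tendsto_iff_norm_sub_tendsto_zero.1 hx⟩

theorem leftInner_add {A B : C} (x y z : B ⟶ A) :
    leftInner (x + y) z = leftInner x z + leftInner y z := comp_add _ _ _

theorem star_leftInner {A B : C} (x y : B ⟶ A) : star (leftInner x y) = leftInner y x := by
  change adj (adj y ≫ x) = adj x ≫ y
  rw [adj_comp, adj_adj]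

theorem star_rightInner {A B : C} (x y : B ⟶ A) : star (rightInner x y) = rightInner y x := by
  change adj (y ≫ adj x) = x ≫ adj y
  rw [adj_comp, adj_adj]

theorem leftInner_add_right {A B : C} (x y z : B ⟶ A) :
    leftInner x (y + z) = leftInner x y + leftInner x z := by
  change adj (y + z) ≫ x = adj y ≫ x + adj z ≫ x
  rw [adj_add, add_comp]

theorem leftInner_smul_right {A B : C} (c : ℂ) (x y : B ⟶ A) :
    leftInner x (c • y) = starRingEnd ℂ c • leftInner x y := by
  change adj (c • y) ≫ x = starRingEnd ℂ c • (adj y ≫ x)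
  rw [adj_smul, smul_comp]

theorem exists_leftInner_self {A B : C} (x : B ⟶ A) : ∃ a : End A, leftInner x x = star a * a := by
  obtain ⟨y, hy⟩ := exists_comp_adj_eq (adj x)
  rw [adj_adj] at hy
  exact ⟨y, hy⟩

theorem isHilbertBimodule (A B : C) :
    IsHilbertBimodule (leftInner : (B ⟶ A) → (B ⟶ A) → End A)
      (rightInner : (B ⟶ A) → (B ⟶ A) → End B) where
  smul_comm a b x := by
    change (b : B ⟶ B) ≫ (x ≫ (a : A ⟶ A)) = (b ≫ x) ≫ a
    rw [Category.assoc]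
  complex_smul c x := by
    change x ≫ (c • 𝟙 A) = (c • 𝟙 B) ≫ x
    rw [smul_comp, comp_smul, Category.comp_id, Category.id_comp]
  left_add := leftInner_add
  left_smul a x y := (Category.assoc (adj y) x a).symm
  left_star x y := (star_leftInner x y).symm
  left_nonneg := exists_leftInner_self
  left_definite x h := norm_eq_zero.1 <| pow_eq_zero_iff two_ne_zero |>.1 <| by
    rw [← norm_leftInner_self, h, norm_zero]
  right_add x y z := add_comp x y (adj z)
  right_smul b x y := Category.assoc (b : B ⟶ B) y (adj x)
  right_star x y := (star_rightInner x y).symm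
  right_nonneg := exists_comp_adj_eq
  right_definite x h := comp_adj_eq_zero h
  right_left_smul a x y := by
    change (y ≫ (a : A ⟶ A)) ≫ adj x = y ≫ adj (x ≫ adj a)
    rw [adj_comp, adj_adj, Category.assoc]
  left_right_smul b x y := by
    change adj y ≫ ((b : B ⟶ B) ≫ x) = adj (adj b ≫ y) ≫ x
    rw [adj_comp, adj_adj, Category.assoc]
  left_complete := completeForNorm_of_eq fun x => by
    rw [norm_leftInner_self, Real.sqrt_sq (norm_nonneg x)]
  right_complete := completeForNorm_of_eq fun x => by
    rw [norm_rightInner_self, Real.sqrt_sq (norm_nonneg x)]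

theorem isImprimitivityBimodule (hfull : IsFull C) (A B : C) :
    IsImprimitivityBimodule (leftInner : (B ⟶ A) → (B ⟶ A) → End A)
      (rightInner : (B ⟶ A) → (B ⟶ A) → End B) where
  toIsHilbertBimodule := isHilbertBimodule A B
  left_full := (hfull A B).1
  right_full := (hfull A B).2
  imprimitivity x y z := (Category.assoc z (adj y) x).symm

/-- The span is dense by fullness and a left ideal because a(x*y) = (xa*)*y. What is used later is
that 1 is a finite combination of elements x*y. -/
theorem span_rightInner_eq_top (hfull : IsFull C) (A B : C) :
    Submodule.span ℂ (Set.range fun p : (B ⟶ A) × (B ⟶ A) => rightInner p.1 p.2) = ⊤ := by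
  refine Submodule.eq_top_of_closure_eq_univ _ (hfull A B).2 fun a b hb => ?_
  induction hb using Submodule.span_induction with
  | mem b hb =>
    obtain ⟨⟨x, y⟩, rfl⟩ := hb
    refine Submodule.subset_span ⟨⟨adj (a : B ⟶ B) ≫ x, y⟩, ?_⟩
    change y ≫ adj (adj a ≫ x) = (y ≫ adj x) ≫ a
    rw [adj_comp, adj_adj, Category.assoc]
  | zero => rw [mul_zero]; exact zero_mem _
  | add b c _ _ hb hc => rw [mul_add]; exact add_mem hb hc
  | smul c b _ hb => rw [mul_smul_comm]; exact Submodule.smul_mem _ _ hb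

theorem span_leftInner_eq_top (hfull : IsFull C) (A B : C) :
    Submodule.span ℂ (Set.range fun p : (B ⟶ A) × (B ⟶ A) => leftInner p.1 p.2) = ⊤ := by
  refine Submodule.eq_top_of_closure_eq_univ _ (hfull A B).1 fun a b hb => ?_
  induction hb using Submodule.span_induction with
  | mem b hb =>
    obtain ⟨⟨x, y⟩, rfl⟩ := hb
    exact Submodule.subset_span ⟨⟨x ≫ (a : A ⟶ A), y⟩, (Category.assoc (adj y) x a).symm⟩
  | zero => rw [mul_zero]; exact zero_mem _
  | add b c _ _ hb hc => rw [mul_add]; exact add_mem hb hc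
  | smul c b _ hb => rw [mul_smul_comm]; exact Submodule.smul_mem _ _ hb

/-! ### The fibre at a character -/

/-- The space `Hom(B, A)` with the semi-inner product `χ(y x*)`. -/
def PreFiber (A B : C) (_χ : WeakDual.characterSpace ℂ (End A)) : Type v := B ⟶ A

section Fiber

variable {A B : C} (χ : WeakDual.characterSpace ℂ (End A))

instance : AddCommGroup (PreFiber A B χ) := inferInstanceAs (AddCommGroup (B ⟶ A))

instance : Module ℂ (PreFiber A B χ) := inferInstanceAs (Module ℂ (B ⟶ A))

theorem conj_char_leftInner (x y : B ⟶ A) :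
    starRingEnd ℂ (χ (leftInner x y)) = χ (leftInner y x) := by
  rw [← star_leftInner x y, map_star]
  rfl

/-- The positivity axiom writes xx* as a*a with a in `End A`, whence χ(xx*) = |χ(a)|². -/
theorem char_leftInner_self_nonneg (x : B ⟶ A) : 0 ≤ (χ (leftInner x x)).re := by
  obtain ⟨a, ha⟩ := exists_leftInner_self x
  rw [ha, map_mul, map_star, RCLike.star_def, ← Complex.normSq_eq_conj_mul_self, Complex.ofReal_re]
  exact Complex.normSq_nonneg _

/-- The semi-inner product `χ(y x*)`. -/
@[reducible] def preFiberCore : PreInnerProductSpace.Core ℂ (PreFiber A B χ) where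
  inner x y := χ (leftInner (A := A) (B := B) y x)
  conj_inner_symm x y := conj_char_leftInner (A := A) (B := B) χ x y
  re_inner_nonneg := char_leftInner_self_nonneg (A := A) (B := B) χ
  add_left x y z := (congrArg χ (leftInner_add_right (A := A) (B := B) z x y)).trans (map_add χ _ _)
  smul_left x y r :=
    (congrArg χ (leftInner_smul_right (A := A) (B := B) r y x)).trans (map_smul χ _ _)

instance : SeminormedAddCommGroup (PreFiber A B χ) :=
  @InnerProductSpace.Core.toSeminormedAddCommGroup ℂ _ _ _ _ (preFiberCore χ)

instance : InnerProductSpace ℂ (PreFiber A B χ) := InnerProductSpace.ofCore (preFiberCore χ)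

/-- The fibre of `Hom(B, A)` at a character `χ` of `End A`: the inner product space associated with
the semi-inner product `χ(y x*)`. -/
def CharFiber (A B : C) (χ : WeakDual.characterSpace ℂ (End A)) : Type v :=
  SeparationQuotient (PreFiber A B χ)

instance : NormedAddCommGroup (CharFiber A B χ) :=
  inferInstanceAs (NormedAddCommGroup (SeparationQuotient (PreFiber A B χ)))

instance : InnerProductSpace ℂ (CharFiber A B χ) :=
  inferInstanceAs (InnerProductSpace ℂ (SeparationQuotient (PreFiber A B χ)))

/-- The identity, from `Hom(B, A)` to its copy with the semi-inner product of `χ`. -/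
def toPreFiber : (B ⟶ A) →+ PreFiber A B χ := AddMonoidHom.id (B ⟶ A)

/-- The class of a morphism in the fibre at `χ`. -/
def toCharFiber : (B ⟶ A) →+ CharFiber A B χ :=
  (SeparationQuotient.mkAddMonoidHom : PreFiber A B χ →+ SeparationQuotient (PreFiber A B χ)).comp
    (toPreFiber χ)

theorem toCharFiber_surjective : Function.Surjective (toCharFiber (B := B) χ) := fun q => by
  obtain ⟨x, rfl⟩ := SeparationQuotient.surjective_mk (X := PreFiber A B χ) q
  exact ⟨x, rfl⟩

theorem inner_toCharFiber (x y : B ⟶ A) :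
    inner ℂ (toCharFiber χ x) (toCharFiber χ y) = χ (leftInner y x) := rfl

/-- This says that the fibre has dimension at most one. It rests on the commutation of e*e with x*x
in the other diagonal block, `End B`, multiplied by e on the left and by x*xe* on the right. -/
theorem charFiber_inner_smul (hcomm : IsCommutative C) (a b c : CharFiber A B χ) :
    inner ℂ a b • c = inner ℂ a c • b := by
  refine inner_smul_eq_inner_smul_of_sq (fun e x => ?_) a b c
  obtain ⟨e, rfl⟩ := toCharFiber_surjective χ e
  obtain ⟨x, rfl⟩ := toCharFiber_surjective χ x
  have key : (leftInner e x * leftInner x e) * (leftInner e x * leftInner x e) =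
      leftInner e e * leftInner e x * (leftInner x x * leftInner x e) := by
    have h : (e ≫ adj e) ≫ (x ≫ adj x) = (x ≫ adj x) ≫ (e ≫ adj e) :=
      hcomm B (End.of (x ≫ adj x)) (End.of (e ≫ adj e))
    have h1 := congrArg (fun t => (adj e ≫ x ≫ adj x) ≫ t ≫ e) h
    change ((adj e ≫ x) ≫ (adj x ≫ e)) ≫ ((adj e ≫ x) ≫ (adj x ≫ e)) =
      ((adj e ≫ x) ≫ (adj x ≫ x)) ≫ (adj x ≫ e) ≫ (adj e ≫ e)
    simpa only [Category.assoc] using h1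
  have h2 := congrArg χ key
  simp only [map_mul] at h2
  simp only [inner_toCharFiber]
  linear_combination h2

end Fiber

/-- In a commutative C*-category `z y* x = x y* z`. -/
theorem comp_adj_comp_swap (hcomm : IsCommutative C) {A B : C} (x y z : B ⟶ A) :
    x ≫ adj y ≫ z = z ≫ adj y ≫ x := by
  -- The one-dimensionality of the fibres, paired with w at every character: (xw*)(zy*) =
  -- (xy*)(zw*).
  have h4 : ∀ w : B ⟶ A, leftInner x w * leftInner z y = leftInner x y * leftInner z w := by
    intro w
    refine eq_of_forall_character_eq (hcomm A) fun χ => ?_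
    have h := congrArg (inner ℂ (toCharFiber χ w))
      (charFiber_inner_smul χ hcomm (toCharFiber χ y) (toCharFiber χ z) (toCharFiber χ x))
    simp only [inner_smul_right, inner_toCharFiber] at h
    rw [map_mul, map_mul, mul_comm, h]
  rw [← sub_eq_zero]
  set d := x ≫ adj y ≫ z - z ≫ adj y ≫ x with hd
  -- With w = d, both terms of d have the same product with d*, so dd* = 0.
  have h5 : adj d ≫ x ≫ adj y ≫ z = adj d ≫ z ≫ adj y ≫ x := by
    have h6 : (adj y ≫ z) ≫ (adj d ≫ x) = (adj d ≫ z) ≫ (adj y ≫ x) := h4 d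
    have h7 : (adj y ≫ z) ≫ (adj d ≫ x) = (adj d ≫ x) ≫ (adj y ≫ z) :=
      hcomm A (leftInner x d) (leftInner z y)
    rw [h7] at h6
    simpa only [Category.assoc] using h6
  refine (isHilbertBimodule A B).left_definite d ?_
  change adj d ≫ d = 0
  nth_rw 2 [hd]
  rw [comp_sub', h5, sub_self]

/-! ### The isomorphism of the diagonal blocks -/

/-- Well-definedness on combinations of x*y comes from an explicit formula. For b = u*z the map c ↦
zcu* works, since (zx*)(yu*) = (yu*)(zx*) = y(u*z)x*. The statement twisted by b is additive in b,
and b = 1 lies in the span. -/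
theorem exists_linearMap_rightInner (hfull : IsFull C) (hcomm : IsCommutative C) (A B : C) :
    ∃ T : End B →ₗ[ℂ] End A, ∀ x y : B ⟶ A, T (rightInner x y) = leftInner y x := by
  have key : ∀ b ∈ Submodule.span ℂ
      (Set.range fun p : (B ⟶ A) × (B ⟶ A) => rightInner p.1 p.2),
      ∃ T : End B →ₗ[ℂ] End A, ∀ x y : B ⟶ A,
        T (rightInner x y) = leftInner ((b : B ⟶ B) ≫ y) x := by
    intro b hb
    induction hb using Submodule.span_induction with
    | mem b hb =>
      obtain ⟨⟨u, z⟩, rfl⟩ := hb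
      refine ⟨{ toFun := fun c => End.of (adj u ≫ (c : B ⟶ B) ≫ z)
                map_add' := fun c d => ?_
                map_smul' := fun r c => ?_ }, fun x y => ?_⟩
      · change adj u ≫ ((c : B ⟶ B) + d) ≫ z = adj u ≫ (c : B ⟶ B) ≫ z + adj u ≫ (d : B ⟶ B) ≫ z
        rw [add_comp, comp_add]
      · change adj u ≫ (r • (c : B ⟶ B)) ≫ z = r • (adj u ≫ (c : B ⟶ B) ≫ z)
        rw [smul_comp, comp_smul]
      · change adj u ≫ (y ≫ adj x) ≫ z = adj x ≫ (z ≫ adj u) ≫ y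
        have h : (adj u ≫ y) ≫ (adj x ≫ z) = (adj x ≫ z) ≫ (adj u ≫ y) :=
          hcomm A (leftInner z x) (leftInner y u)
        simpa only [Category.assoc] using h
    | zero =>
      refine ⟨0, fun x y => ?_⟩
      change 0 = adj x ≫ (0 : B ⟶ B) ≫ y
      rw [zero_comp', comp_zero']
    | add b c _ _ hb hc =>
      obtain ⟨T, hT⟩ := hb
      obtain ⟨S, hS⟩ := hc
      refine ⟨T + S, fun x y => ?_⟩
      rw [LinearMap.add_apply, hT, hS]
      change adj x ≫ (b : B ⟶ B) ≫ y + adj x ≫ (c : B ⟶ B) ≫ y = adj x ≫ ((b : B ⟶ B) + c) ≫ y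
      rw [add_comp, comp_add]
    | smul r b _ hb =>
      obtain ⟨T, hT⟩ := hb
      refine ⟨r • T, fun x y => ?_⟩
      rw [LinearMap.smul_apply, hT]
      change r • (adj x ≫ (b : B ⟶ B) ≫ y) = adj x ≫ (r • (b : B ⟶ B)) ≫ y
      rw [smul_comp, comp_smul]
  obtain ⟨T, hT⟩ := key 1 (by rw [span_rightInner_eq_top hfull A B]; trivial)
  refine ⟨T, fun x y => (hT x y).trans ?_⟩
  change adj x ≫ 𝟙 B ≫ y = adj x ≫ y
  rw [Category.id_comp]

/-- The *-isomorphism of diagonal blocks taking `x* y` to `y x*`. -/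
theorem exists_starAlgEquiv_rightInner (hfull : IsFull C) (hcomm : IsCommutative C) (A B : C) :
    ∃ φ : End B ≃⋆ₐ[ℂ] End A, ∀ x y : B ⟶ A, φ (rightInner x y) = leftInner y x := by
  obtain ⟨T, hT⟩ := exists_linearMap_rightInner hfull hcomm A B
  -- The same map with A and B exchanged, evaluated on adjoints, is the inverse.
  obtain ⟨S, hS⟩ := exists_linearMap_rightInner hfull hcomm B A
  have hS' : ∀ x y : B ⟶ A, S (leftInner y x) = rightInner x y := by
    intro x y
    have h := hS (adj y) (adj x)
    change S (End.of (adj x ≫ adj (adj y))) = adj (adj y) ≫ adj x at h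
    rw [adj_adj] at h
    exact h
  have hr := span_rightInner_eq_top hfull A B
  have hl := span_leftInner_eq_top hfull A B
  have hST : ∀ b, S (T b) = b := by
    intro b
    have h : S ∘ₗ T = LinearMap.id := LinearMap.ext_on hr (by
      rintro _ ⟨⟨x, y⟩, rfl⟩
      change S (T (rightInner x y)) = rightInner x y
      rw [hT, hS'])
    exact LinearMap.congr_fun h b
  have hTS : ∀ a, T (S a) = a := by
    intro a
    have h : T ∘ₗ S = LinearMap.id := LinearMap.ext_on hl (by
      rintro _ ⟨⟨x, y⟩, rfl⟩
      change T (S (leftInner x y)) = leftInner x y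
      rw [hS', hT])
    exact LinearMap.congr_fun h a
  have hmul : ∀ b c, T (b * c) = T b * T c := by
    intro b c
    have hb : b ∈ Submodule.span ℂ
      (Set.range fun p : (B ⟶ A) × (B ⟶ A) => rightInner p.1 p.2) := by rw [hr]; trivial
    have hc : c ∈ Submodule.span ℂ
      (Set.range fun p : (B ⟶ A) × (B ⟶ A) => rightInner p.1 p.2) := by rw [hr]; trivial
    induction hb, hc using Submodule.span_induction₂ with
    | mem_mem b c hb hc =>
      obtain ⟨⟨x, y⟩, rfl⟩ := hb
      obtain ⟨⟨z, w⟩, rfl⟩ := hc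
      have h : rightInner x y * rightInner z w = rightInner (x ≫ adj y ≫ z) w := by
        change (w ≫ adj z) ≫ (y ≫ adj x) = w ≫ adj (x ≫ adj y ≫ z)
        simp only [adj_comp, adj_adj, Category.assoc]
      change T (rightInner x y * rightInner z w) = T (rightInner x y) * T (rightInner z w)
      rw [h, hT, hT, hT]
      change adj (x ≫ adj y ≫ z) ≫ w = (adj z ≫ w) ≫ (adj x ≫ y)
      simp only [adj_comp, adj_adj, Category.assoc]
      -- On generators, multiplicativity amounts to wx*y = yx*w.
      rw [comp_adj_comp_swap hcomm w x y]
    | zero_left => simp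
    | zero_right => simp
    | add_left _ _ _ _ _ _ h1 h2 => rw [add_mul, map_add, map_add, add_mul, h1, h2]
    | add_right _ _ _ _ _ _ h1 h2 => rw [mul_add, map_add, map_add, mul_add, h1, h2]
    | smul_left r _ _ _ _ h => rw [smul_mul_assoc, map_smul, map_smul, smul_mul_assoc, h]
    | smul_right r _ _ _ _ h => rw [mul_smul_comm, map_smul, map_smul, mul_smul_comm, h]
  have hstar : ∀ b, T (star b) = star (T b) := by
    intro b
    have hb : b ∈ Submodule.span ℂ
      (Set.range fun p : (B ⟶ A) × (B ⟶ A) => rightInner p.1 p.2) := by rw [hr]; trivial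
    induction hb using Submodule.span_induction with
    | mem b hb =>
      obtain ⟨⟨x, y⟩, rfl⟩ := hb
      change T (star (rightInner x y)) = star (T (rightInner x y))
      rw [star_rightInner, hT, hT, star_leftInner]
    | zero => simp
    | add _ _ _ _ h1 h2 => rw [star_add, map_add, map_add, star_add, h1, h2]
    | smul r _ _ h => rw [star_smul, map_smul, map_smul, star_smul, h]
  exact ⟨{ toFun := T, invFun := S, left_inv := hST, right_inv := hTS, map_mul' := hmul,
           map_add' := map_add T, map_star' := hstar, map_smul' := map_smul T }, hT⟩

/-- A *-isomorphism is determined by its values on the elements `x* y`. -/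
theorem starAlgEquiv_ext_rightInner (hfull : IsFull C) {A B : C} {φ ψ : End B ≃⋆ₐ[ℂ] End A}
    (h : ∀ x y : B ⟶ A, φ (rightInner x y) = ψ (rightInner x y)) : φ = ψ := by
  have h1 : (φ.toAlgEquiv : End B →ₐ[ℂ] End A).toLinearMap =
      (ψ.toAlgEquiv : End B →ₐ[ℂ] End A).toLinearMap :=
    LinearMap.ext_on (span_rightInner_eq_top hfull A B) (by
      rintro _ ⟨⟨x, y⟩, rfl⟩
      exact h x y)
  exact StarAlgEquiv.ext fun b => LinearMap.congr_fun h1 b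

end CStarCategory

/-! ### Hermitian line bundles from families of sections -/

section FamilyOfSections

variable {X : Type u} [TopologicalSpace X] {ι : Type*} {E : X → Type w}
  [∀ x, NormedAddCommGroup (E x)] [∀ x, InnerProductSpace ℂ (E x)]

/-- In a space of dimension at most one, `v = ⟪e, e⟫⁻¹ ⟪e, v⟫ e`. -/
theorem inner_inv_mul_inner_smul {F : Type*} [NormedAddCommGroup F] [InnerProductSpace ℂ F]
    (h : ∀ a b c : F, inner ℂ a b • c = inner ℂ a c • b) {e : F} (he : e ≠ 0) (v : F) :
    ((inner ℂ e e)⁻¹ * inner ℂ e v) • e = v := by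
  rw [mul_smul, ← h e e v, smul_smul, inv_mul_cancel₀ (inner_self_ne_zero.2 he), one_smul]

/-- Data for a Hermitian line bundle: sections of a family of inner product spaces of dimension at
most one, with continuous mutual inner products and without common zeros. -/
structure LineSections (s : ι → ∀ x, E x) : Prop where
  inner_smul : ∀ x (a b c : E x), inner ℂ a b • c = inner ℂ a c • b
  continuous_inner : ∀ i j, Continuous fun x => inner ℂ (s i x) (s j x)
  exists_ne_zero : ∀ x, ∃ i, s i x ≠ 0

namespace LineSections

variable {s : ι → ∀ x, E x} (hs : LineSections s)

include hs in
theorem isOpen_ne_zero (i : ι) : IsOpen {x | s i x ≠ 0} := by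
  have h : {x | s i x ≠ 0} = (fun x => inner ℂ (s i x) (s i x)) ⁻¹' {0}ᶜ := by
    ext x
    simp
  rw [h]
  exact isOpen_compl_singleton.preimage (hs.continuous_inner i i)

/-- The trivialization `v ↦ ⟪s i x, v⟫` over the set where `s i` does not vanish. -/
def pretrivialization (i : ι) : Pretrivialization ℂ (π ℂ E) where
  toFun p := (p.1, inner ℂ (s i p.1) p.2)
  invFun q := ⟨q.1, ((inner ℂ (s i q.1) (s i q.1))⁻¹ * q.2) • s i q.1⟩
  source := π ℂ E ⁻¹' {x | s i x ≠ 0}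
  target := {x | s i x ≠ 0} ×ˢ Set.univ
  map_source' p hp := ⟨hp, trivial⟩
  map_target' q hq := hq.1
  left_inv' p hp := by
    refine TotalSpace.ext rfl (heq_of_eq ?_)
    exact inner_inv_mul_inner_smul (hs.inner_smul _) hp _
  right_inv' q hq := by
    refine Prod.ext rfl ?_
    have h : inner ℂ (s i q.1) (s i q.1) ≠ 0 := inner_self_ne_zero.2 hq.1
    simp only [inner_smul_right]
    field_simp
  open_target := (hs.isOpen_ne_zero i).prod isOpen_univ
  baseSet := {x | s i x ≠ 0}
  open_baseSet := hs.isOpen_ne_zero i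
  source_eq := rfl
  target_eq := rfl
  proj_toFun _ _ := rfl

theorem pretrivialization_apply (i : ι) (x : X) (v : E x) :
    hs.pretrivialization i ⟨x, v⟩ = (x, inner ℂ (s i x) v) := rfl

theorem pretrivialization_symm_apply {i : ι} {x : X} (hx : s i x ≠ 0) (z : ℂ) :
    (hs.pretrivialization i).symm x z = ((inner ℂ (s i x) (s i x))⁻¹ * z) • s i x := by
  have hx' : x ∈ (hs.pretrivialization i).baseSet := hx
  rw [Pretrivialization.symm_apply _ hx']
  rfl

/-- The vector prebundle of a family of sections. -/
def vectorPrebundle : VectorPrebundle ℂ ℂ E where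
  pretrivializationAtlas := Set.range hs.pretrivialization
  pretrivialization_linear' := by
    rintro _ ⟨i, rfl⟩
    exact ⟨fun x _ => ⟨fun v w => inner_add_right _ _ _, fun c v => inner_smul_right _ _ _⟩⟩
  pretrivializationAt x := hs.pretrivialization (hs.exists_ne_zero x).choose
  mem_base_pretrivializationAt x := (hs.exists_ne_zero x).choose_spec
  pretrivialization_mem_atlas x := ⟨_, rfl⟩
  exists_coordChange := by
    rintro _ ⟨i, rfl⟩ _ ⟨j, rfl⟩
    -- A vector with coordinate z for `s i` is z⟨sᵢ, sᵢ⟩⁻¹sᵢ; pairing it with `s j` gives the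
    -- transition factor.
    refine ⟨fun x => ContinuousLinearMap.toSpanSingleton ℂ
      ((inner ℂ (s i x) (s i x))⁻¹ * inner ℂ (s j x) (s i x)), ?_, ?_⟩
    · refine (ContinuousLinearMap.toSpanSingletonCLE (𝕜 := ℂ) (E := ℂ)).continuous.comp_continuousOn ?_
      refine ContinuousOn.mul ?_ (hs.continuous_inner j i).continuousOn
      exact (hs.continuous_inner i i).continuousOn.inv₀ fun x hx => inner_self_ne_zero.2 hx.1
    · rintro x ⟨hi, hj⟩ z
      rw [hs.pretrivialization_symm_apply hi, pretrivialization_apply, inner_smul_right,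
        ContinuousLinearMap.toSpanSingleton_apply, smul_eq_mul]
      ring
  totalSpaceMk_isInducing x := by
    obtain ⟨i, hi⟩ : ∃ i, i = (hs.exists_ne_zero x).choose := ⟨_, rfl⟩
    have hx : s i x ≠ 0 := hi ▸ (hs.exists_ne_zero x).choose_spec
    rw [← hi]
    have hx' : inner ℂ (s i x) (s i x) ≠ 0 := inner_self_ne_zero.2 hx
    let e : E x ≃ₜ ℂ :=
      { toFun := fun v => inner ℂ (s i x) v
        invFun := fun z => ((inner ℂ (s i x) (s i x))⁻¹ * z) • s i x
        left_inv := fun v => inner_inv_mul_inner_smul (hs.inner_smul _) hx v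
        right_inv := fun z => by
          simp only [inner_smul_right]
          field_simp
        continuous_toFun := by fun_prop
        continuous_invFun := by fun_prop }
    exact (isInducing_prodMkRight x).comp e.isInducing

/-- Pairing with a member of the family is continuous on the total space. -/
theorem continuous_inner_totalSpace (i : ι) :
    Continuous[hs.vectorPrebundle.totalSpaceTopology, _]
      fun v : TotalSpace ℂ E => inner ℂ (s i v.1) v.2 := by
  let _ := hs.vectorPrebundle.totalSpaceTopology
  let _ := hs.vectorPrebundle.toFiberBundle
  rw [continuous_iff_continuousAt]
  rintro p
  obtain ⟨j, hj⟩ : ∃ j, j = (hs.exists_ne_zero p.1).choose := ⟨_, rfl⟩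
  have hp : s j p.1 ≠ 0 := hj ▸ (hs.exists_ne_zero p.1).choose_spec
  have he : ∀ v : TotalSpace ℂ E, trivializationAt ℂ E p.1 v = (v.1, inner ℂ (s j v.1) v.2) := by
    intro v
    rw [hj]
    rfl
  have h1 : ContinuousAt (fun v : TotalSpace ℂ E => inner ℂ (s j v.1) v.2) p := by
    have h2 := (trivializationAt ℂ E p.1).continuousAt (x := p)
      (FiberBundle.mem_trivializationAt_proj_source)
    refine (continuous_snd.continuousAt.comp h2).congr (Filter.Eventually.of_forall fun v => ?_)
    exact congrArg Prod.snd (he v)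
  have hπ : Continuous (π ℂ E) := FiberBundle.continuous_proj ℂ E
  have hc : ∀ k l, Continuous fun v : TotalSpace ℂ E => inner ℂ (s k v.1) (s l v.1) :=
    fun k l => (hs.continuous_inner k l).comp hπ
  -- Where sⱼ ≠ 0, one has ⟨sᵢ, v⟩ = ⟨sⱼ, sⱼ⟩⁻¹⟨sⱼ, v⟩⟨sᵢ, sⱼ⟩, and the only factor not pulled back
  -- from the base is the local coordinate of v.
  have h3 : ContinuousAt (fun v : TotalSpace ℂ E =>
      ((inner ℂ (s j v.1) (s j v.1))⁻¹ * inner ℂ (s j v.1) v.2) * inner ℂ (s i v.1) (s j v.1)) p :=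
    (((hc j j).continuousAt.inv₀ (inner_self_ne_zero.2 hp)).mul h1).mul (hc i j).continuousAt
  refine h3.congr ?_
  filter_upwards [((hs.isOpen_ne_zero j).preimage hπ).mem_nhds hp] with v hv
  rw [← inner_smul_right, inner_inv_mul_inner_smul (hs.inner_smul _) hv]

/-- The Hermitian line bundle of a family of sections. -/
def hermitianLineBundle : HermitianLineBundle.{u, w} X :=
  letI := hs.vectorPrebundle.totalSpaceTopology
  letI := hs.vectorPrebundle.toFiberBundle
  { Fiber := E
    vectorBundle := hs.vectorPrebundle.toVectorBundle
    continuous_inner := by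
      have hd := (FiberBundle.Prod.isInducing_diag ℂ E ℂ E).continuous
      have hfst : Continuous fun p : TotalSpace (ℂ × ℂ) (E ×ᵇ E) =>
          (⟨p.1, p.2.1⟩ : TotalSpace ℂ E) := continuous_fst.comp hd
      have hsnd : Continuous fun p : TotalSpace (ℂ × ℂ) (E ×ᵇ E) =>
          (⟨p.1, p.2.2⟩ : TotalSpace ℂ E) := continuous_snd.comp hd
      have hπ : Continuous fun p : TotalSpace (ℂ × ℂ) (E ×ᵇ E) => p.1 :=
        (FiberBundle.continuous_proj ℂ E).comp hfst
      rw [continuous_iff_continuousAt]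
      intro p
      obtain ⟨j, hj⟩ := hs.exists_ne_zero p.1
      have h1 := ((hs.continuous_inner j j).comp hπ).continuousAt (x := p)
      have h2 := ((hs.continuous_inner_totalSpace j).comp hfst).continuousAt (x := p)
      have h3 := ((hs.continuous_inner_totalSpace j).comp hsnd).continuousAt (x := p)
      -- Locally ⟨v, w⟩ = ⟨s, s⟩⁻¹⟨s, w⟩⟨v, s⟩ for a member s of the family that does not vanish at
      -- the point.
      have h4 := ((h1.inv₀ (inner_self_ne_zero.2 hj)).mul h3).mul
        (Complex.continuous_conj.continuousAt.comp h2)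
      refine h4.congr ?_
      filter_upwards [((hs.isOpen_ne_zero j).preimage hπ).mem_nhds hj] with v hv
      have h5 := inner_inv_mul_inner_smul (hs.inner_smul _) hv v.2.2
      refine Eq.trans ?_ ((inner_smul_right _ _ _).symm.trans (congrArg (inner ℂ v.2.1) h5))
      exact congrArg (fun t : ℂ => _ * t) (inner_conj_symm v.2.1 (s j v.1)) }

/-- The members of the family are continuous sections of the bundle. -/
theorem mem_sections (i : ι) : s i ∈ hs.hermitianLineBundle.sections := by
  let _ := hs.vectorPrebundle.totalSpaceTopology
  let _ := hs.vectorPrebundle.toFiberBundle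
  change Continuous fun x => (⟨x, s i x⟩ : TotalSpace ℂ E)
  rw [continuous_iff_continuousAt]
  intro x
  refine (FiberBundle.continuousAt_totalSpace ℂ _).2 ⟨continuousAt_id, ?_⟩
  -- In a local trivialization the coordinate of `s i` is its inner product with another member.
  exact (hs.continuous_inner _ i).continuousAt

end LineSections

end FamilyOfSections

/-! ### The bimodule of sections -/

namespace CStarCategory

variable {C : Type u} [Category.{v} C] [CStarCategory C]

/-- Otherwise χ would vanish on every xy*, hence on their span, which contains 1. -/
theorem exists_toCharFiber_ne_zero (hfull : IsFull C) {A : C} (B : C)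
    (χ : WeakDual.characterSpace ℂ (End A)) : ∃ x : B ⟶ A, toCharFiber χ x ≠ 0 := by
  by_contra! h
  have h1 : (1 : End A) ∈ Submodule.span ℂ
      (Set.range fun p : (B ⟶ A) × (B ⟶ A) => leftInner p.1 p.2) := by
    rw [span_leftInner_eq_top hfull]
    trivial
  have h2 : ∀ a ∈ Submodule.span ℂ
      (Set.range fun p : (B ⟶ A) × (B ⟶ A) => leftInner p.1 p.2), χ a = 0 := by
    intro a ha
    induction ha using Submodule.span_induction with
    | mem a ha =>
      obtain ⟨⟨x, y⟩, rfl⟩ := ha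
      change χ (leftInner x y) = 0
      rw [← inner_toCharFiber, h, inner_zero_left]
    | zero => exact map_zero χ
    | add a b _ _ ha hb => rw [map_add, ha, hb, add_zero]
    | smul c a _ ha => rw [map_smul, ha, smul_zero]
  exact one_ne_zero ((map_one χ).symm.trans (h2 1 h1))

theorem toCharFiber_ext {A B : C} {χ : WeakDual.characterSpace ℂ (End A)}
    {v w : CharFiber A B χ}
    (h : ∀ z : B ⟶ A, inner ℂ (toCharFiber χ z) v = inner ℂ (toCharFiber χ z) w) : v = w := by
  refine ext_inner_left ℂ fun u => ?_
  obtain ⟨z, rfl⟩ := toCharFiber_surjective χ u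
  exact h z

theorem toCharFiber_smul {A B : C} (χ : WeakDual.characterSpace ℂ (End A)) (a : End A) (x : B ⟶ A) :
    toCharFiber χ (a • x) = χ a • toCharFiber χ x := by
  refine toCharFiber_ext fun z => ?_
  rw [inner_smul_right, inner_toCharFiber, inner_toCharFiber, (isHilbertBimodule A B).left_smul,
    map_mul]

variable {Y : Type w} [TopologicalSpace Y] {A : C}

/-- The family of sections `p ↦ [x]` over the graph of a homeomorphism from the spectrum. -/
theorem lineSections (hfull : IsFull C) (hcomm : IsCommutative C) (B : C)
    (R : WeakDual.characterSpace ℂ (End A) ≃ₜ Y) :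
    LineSections (E := fun p : HomeoGraph R => CharFiber A B p.1.1)
      fun (x : B ⟶ A) p => toCharFiber p.1.1 x where
  inner_smul p := charFiber_inner_smul p.1.1 hcomm
  continuous_inner x y :=
    ((WeakDual.gelfandTransform ℂ (End A) (leftInner y x)).comp (graphFst R)).continuous
  exists_ne_zero p := exists_toCharFiber_ne_zero hfull B p.1.1

/-- The Hermitian line bundle of the bimodule `Hom(B, A)`. -/
def lineBundle (hfull : IsFull C) (hcomm : IsCommutative C) (B : C)
    (R : WeakDual.characterSpace ℂ (End A) ≃ₜ Y) : HermitianLineBundle.{max v w, v} (HomeoGraph R) :=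
  (lineSections hfull hcomm B R).hermitianLineBundle

variable (hfull : IsFull C) (hcomm : IsCommutative C) (B : C)
  (R : WeakDual.characterSpace ℂ (End A) ≃ₜ Y)

/-- The continuous section `p ↦ [x]`. -/
def toSections : (B ⟶ A) →+ (lineBundle hfull hcomm B R).sections where
  toFun x := ⟨fun p => toCharFiber p.1.1 x, (lineSections hfull hcomm B R).mem_sections x⟩
  map_zero' := Subtype.ext <| funext fun p => map_zero (toCharFiber p.1.1)
  map_add' x y := Subtype.ext <| funext fun p => map_add (toCharFiber p.1.1) x y

theorem toSections_smul (a : End A) (x : B ⟶ A) :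
    toSections hfull hcomm B R (a • x) =
      (WeakDual.gelfandTransform ℂ (End A) a).comp (graphFst R) • toSections hfull hcomm B R x :=
  Subtype.ext <| funext fun p => toCharFiber_smul p.1.1 a x

include hfull hcomm in
/-- A family of vectors having continuous inner products with all the sections `[x]` is one of
these sections. -/
theorem exists_toCharFiber_eq (τ : ∀ χ : WeakDual.characterSpace ℂ (End A), CharFiber A B χ)
    (hτ : ∀ x : B ⟶ A, Continuous fun χ : WeakDual.characterSpace ℂ (End A) =>
      inner ℂ (toCharFiber χ x) (τ χ)) :
    ∃ x : B ⟶ A, ∀ χ : WeakDual.characterSpace ℂ (End A), toCharFiber χ x = τ χ := by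
  -- Weighting τ by χ(a) makes the claim linear in a, so that a = yx* suffices; a = 1 then recovers
  -- τ.
  have key : ∀ a ∈ Submodule.span ℂ
      (Set.range fun p : (B ⟶ A) × (B ⟶ A) => leftInner p.1 p.2),
      ∃ x : B ⟶ A, ∀ χ : WeakDual.characterSpace ℂ (End A), toCharFiber χ x = χ a • τ χ := by
    intro a ha
    induction ha using Submodule.span_induction with
    | mem a ha =>
      obtain ⟨⟨y, x⟩, rfl⟩ := ha
      obtain ⟨a, ha⟩ := (gelfandTransform_bijective_of_commute (hcomm A)).2 ⟨_, hτ x⟩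
      refine ⟨a • y, fun χ => ?_⟩
      have h1 : χ a = inner ℂ (toCharFiber χ x) (τ χ) := DFunLike.congr_fun ha χ
      rw [toCharFiber_smul, h1]
      exact (charFiber_inner_smul χ hcomm (toCharFiber χ x) (toCharFiber χ y) (τ χ)).symm
    | zero => exact ⟨0, fun p => by rw [map_zero, map_zero, zero_smul]⟩
    | add a b _ _ ha hb =>
      obtain ⟨x, hx⟩ := ha
      obtain ⟨y, hy⟩ := hb
      exact ⟨x + y, fun p => by rw [map_add, map_add, hx, hy, add_smul]⟩
    | smul c a _ ha =>
      obtain ⟨x, hx⟩ := ha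
      refine ⟨algebraMap ℂ (End A) c • x, fun p => ?_⟩
      rw [toCharFiber_smul, hx, smul_smul, Algebra.smul_def, map_mul]
  obtain ⟨x, hx⟩ := key 1 (by rw [span_leftInner_eq_top hfull]; trivial)
  exact ⟨x, fun p => (hx p).trans (by rw [map_one, one_smul])⟩

theorem toSections_injective : Function.Injective (toSections hfull hcomm B R) := by
  rw [injective_iff_map_eq_zero]
  intro x hx
  refine (isHilbertBimodule A B).left_definite x ?_
  refine eq_of_forall_character_eq (hcomm A) fun χ => ?_
  have h := congrFun (congrArg Subtype.val hx) ⟨(χ, R χ), rfl⟩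
  change toCharFiber χ x = 0 at h
  rw [← inner_toCharFiber, h, inner_zero_left, map_zero]

theorem toSections_surjective : Function.Surjective (toSections hfull hcomm B R) := by
  intro σ
  have hg : Continuous fun χ : WeakDual.characterSpace ℂ (End A) =>
      (⟨(χ, R χ), rfl⟩ : HomeoGraph R) := by fun_prop
  have hσ (x : B ⟶ A) (χ : WeakDual.characterSpace ℂ (End A)) :
      (lineBundle hfull hcomm B R).sectionInner (toSections hfull hcomm B R x) σ
        ⟨(χ, R χ), rfl⟩ = inner ℂ (toCharFiber χ x) (σ.1 ⟨(χ, R χ), rfl⟩ : CharFiber A B χ) := rfl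
  obtain ⟨x, hx⟩ := exists_toCharFiber_eq hfull hcomm B (fun χ => σ.1 ⟨(χ, R χ), rfl⟩) fun x => by
    simp_rw [← hσ]
    exact (ContinuousMap.continuous _).comp hg
  refine ⟨x, Subtype.ext <| funext ?_⟩
  rintro ⟨⟨χ, q⟩, hq⟩
  obtain rfl : R χ = q := hq
  exact hx χ

/-- The bimodule `Hom(B, A)` is isomorphic to the bimodule of sections of its line bundle. -/
def sectionIso (φ : End B ≃⋆ₐ[ℂ] End A)
    (hφ : ∀ x y : B ⟶ A, φ (rightInner x y) = leftInner y x) :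
    SectionIso (leftInner : (B ⟶ A) → (B ⟶ A) → End A) rightInner (spectrumHomeo φ)
      (lineBundle hfull hcomm B (spectrumHomeo φ)) where
  toAddEquiv := AddEquiv.ofBijective (toSections hfull hcomm B (spectrumHomeo φ))
    ⟨toSections_injective hfull hcomm B _, toSections_surjective hfull hcomm B _⟩
  map_smul := toSections_smul hfull hcomm B _
  map_op_smul b x := by
    refine Subtype.ext <| funext ?_
    rintro ⟨⟨χ, q⟩, hq⟩
    obtain rfl : spectrumHomeo φ χ = q := hq
    change toCharFiber χ (op b • x) = χ (φ b) • toCharFiber χ x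
    refine toCharFiber_ext fun z => ?_
    -- Through φ, the pairing of xb with z is χ(φ(z*xb)) = χ(φ(z*x))χ(φ(b)).
    rw [inner_smul_right, inner_toCharFiber, inner_toCharFiber, ← hφ, ← hφ,
      (isHilbertBimodule A B).right_smul, map_mul, map_mul, mul_comm]
  map_left x y := rfl
  map_right x y := by
    refine ContinuousMap.ext ?_
    rintro ⟨⟨χ, q⟩, hq⟩
    obtain rfl : spectrumHomeo φ χ = q := hq
    exact congrArg χ (hφ x y)

end CStarCategory

end

theorem mainTheorem2 {C : Type u} [Category.{v} C] [CStarCategory C]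
    (hfull : CStarCategory.IsFull C) (hcomm : CStarCategory.IsCommutative C) (A B : C) :
    IsImprimitivityBimodule
        (CStarCategory.leftInner : (B ⟶ A) → (B ⟶ A) → End A)
        (CStarCategory.rightInner : (B ⟶ A) → (B ⟶ A) → End B) ∧
      IsMoritaEquivalent ℂ (End A) (End B) ∧
      ∃ φ : End B ≃⋆ₐ[ℂ] End A,
        (∀ x y : B ⟶ A,
          φ (End.of (y ≫ CStarCategory.adj x)) = End.of (CStarCategory.adj x ≫ y)) ∧
        (∀ ψ : End B ≃⋆ₐ[ℂ] End A,
          (∀ x y : B ⟶ A,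
            ψ (End.of (y ≫ CStarCategory.adj x)) = End.of (CStarCategory.adj x ≫ y)) → ψ = φ) ∧
        ∃ L : HermitianLineBundle.{v, v} (HomeoGraph (spectrumHomeo φ)),
          Nonempty (SectionIso
            (CStarCategory.leftInner : (B ⟶ A) → (B ⟶ A) → End A)
            (CStarCategory.rightInner : (B ⟶ A) → (B ⟶ A) → End B)
            (spectrumHomeo φ) L) := by
  obtain ⟨φ, hφ⟩ := CStarCategory.exists_starAlgEquiv_rightInner hfull hcomm A B
  exact ⟨CStarCategory.isImprimitivityBimodule hfull A B,
    -- Isomorphic algebras are Morita equivalent, so φ settles this clause.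
    IsMoritaEquivalent.of_algEquiv ℂ φ.symm.toAlgEquiv, φ, hφ,
    fun ψ hψ => CStarCategory.starAlgEquiv_ext_rightInner hfull fun x y =>
      (hψ x y).trans (hφ x y).symm,
    CStarCategory.lineBundle hfull hcomm B (spectrumHomeo φ),
    ⟨CStarCategory.sectionIso hfull hcomm B φ hφ⟩⟩
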